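/- Let $\mathbb V$ be a variety of universal algebras (finitary operations, defined by identities) with a ternary term $p$ and a binary term $\alpha$ such that the identities $$p(x,y,y)=p(y,y,x),\qquad p(x,x,x)=x,\qquad \alpha(p(x,y,y),y)=x$$ hold in $\mathbb V$. Then: 1. $\mathbb V$ is congruence modular: for every algebra $A$ in $\mathbb V$ the lattice of congruences of $A$ is modular. 2. For every split epimorphism $f:X\to Y$ in $\mathbb V$ with chosen section $s:Y\to X$ (that is, for every object of the fibre $Pt_Y\mathbb V$) and every $y\in Y$, the set $f^{-1}(y)$, pointed by $0=s(y)$, is closed under the operations $u\circ v=p(u,s(y),v)$ and $\upsilon(u)=\alpha(u,s(y))$, and with them it is a $\mathrm{Hex}$-algebra: $u\circ 0=0\circ u$ and $\upsilon(u\circ 0)=u$, with $0\circ 0=0$ and $\upsilon(0)=0$. 3. For every $Y$ in $\mathbb V$, the fibre $Pt_Y\mathbb V$ (the category of split epimorphisms onto $Y$ with a chosen section) is congruence hyperextensible. Here a finitely complete pointed category is called congruence hyperextensible if for all morphisms $f:W\to X$ and $g:W\to Z$ with sections $s$ of $f$ and $t$ of $g$ such that $gs=0$ and $ft=0$, and every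 equivalence relation $T$ on $W$ with $R[f]\cap R[g]\subset T$, one has $R[f]\cap g^{-1}(t^{-1}(T))\subset T$, where $R[f]$ denotes the kernel equivalence relation of $f$. 4. $\mathbb V$ is a Gumm category, i.e. it is finitely complete and satisfies the Shifting Lemma: for all equivalence relations $T,S,R$ on an object with $R\cap S\subset T$, if $x\,S\,y$, $x'\,S\,y'$, $x\,R\,x'$, $y\,R\,y'$ and $x\,T\,x'$, then $y\,T\,y'$ (for generalized elements). -/

import Mathlib

open CategoryTheory CategoryTheory.Limits

universe u u' w v₁ u₁

namespace GummVar

/-! ### Varieties of universal algebras -/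

/-- A variety over an algebraic (relation-free) language `L`, presented by a set of identities
between terms in countably many variables. -/
structure Variety (L : FirstOrder.Language.{u, u'}) where
  identities : Set (L.Term ℕ × L.Term ℕ)

namespace Variety

variable {L : FirstOrder.Language.{u, u'}}

/-- The algebra `A` satisfies all the identities of the variety. -/
def Models (V : Variety L) (A : Type w) [L.Structure A] : Prop :=
  ∀ e ∈ V.identities, ∀ x : ℕ → A, e.1.realize x = e.2.realize x

/-- The algebras of the variety with underlying set in `Type w`. -/
structure Alg (V : Variety L) where
  carrier : Type w
  [str : L.Structure carrier]
  models : V.Models carrier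

instance (V : Variety L) : CoeSort V.Alg (Type w) := ⟨Alg.carrier⟩

instance (V : Variety L) (A : V.Alg) : L.Structure A := A.str

/-- The category of algebras of the variety and homomorphisms. -/
instance (V : Variety L) : Category V.Alg where
  Hom A B := L.Hom A B
  id A := FirstOrder.Language.Hom.id L A
  comp f g := FirstOrder.Language.Hom.comp g f

end Variety

/-! ### Congruences -/

/-- A congruence on an `L`-algebra: an equivalence relation compatible with every operation. -/
structure Congruence (L : FirstOrder.Language.{u, u'}) (A : Type w) [L.Structure A] extends Setoid A where
  compat : ∀ {n : ℕ} (F : L.Functions n) (x y : Fin n → A), (∀ i, toSetoid.r (x i) (y i)) →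
    toSetoid.r (FirstOrder.Language.Structure.funMap F x) (FirstOrder.Language.Structure.funMap F y)

namespace Congruence

variable {L : FirstOrder.Language.{u, u'}} {A : Type w} [L.Structure A]

theorem toSetoid_injective :
    Function.Injective (toSetoid : Congruence L A → Setoid A) := by
  rintro ⟨r, _⟩ ⟨s, _⟩ h
  cases h
  rfl

/-- Congruences are ordered by inclusion. -/
instance : PartialOrder (Congruence L A) := PartialOrder.lift toSetoid toSetoid_injective

/-- The intersection of a family of congruences. -/
instance : InfSet (Congruence L A) where
  sInf S :=
    { toSetoid := sInf (toSetoid '' S)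
      compat := by
        rintro n F x y h _ ⟨c, hc, rfl⟩
        exact c.compat F x y fun i => h i _ ⟨c, hc, rfl⟩ }

/-- The lattice of congruences: the meet is the intersection, and the join is the smallest
congruence containing both. -/
instance : CompleteLattice (Congruence L A) :=
  completeLatticeOfInf _ fun S =>
    ⟨fun c hc _ _ h => h _ ⟨c, hc, rfl⟩,
     fun _ hd _ _ h => by
      rintro _ ⟨c, hc, rfl⟩
      exact hd hc h⟩

end Congruence

/-- A variety is congruence modular when the congruence lattice of each of its algebras is
modular. -/
def Variety.IsCongruenceModular {L : FirstOrder.Language.{u, u'}} (V : Variety L) : Prop :=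
  ∀ A : Variety.Alg.{u, u', w} V, IsModularLattice (Congruence L A)

/-! ### Internal equivalence relations, Gumm categories, congruence hyperextensible categories -/

section Categorical

variable {C : Type u₁} [Category.{v₁} C]

/-- An equivalence relation on the object `X`, represented by its two legs. -/
structure InternalEquiv (X : C) where
  obj : C
  d₀ : obj ⟶ X
  d₁ : obj ⟶ X
  isEquivalenceRelation : IsEquivalenceRelation d₀ d₁

/-- The generalized elements `x` and `y` of `X` are related by `T`. -/
def InternalEquiv.Rel {X : C} (T : InternalEquiv X) {U : C} (x y : U ⟶ X) : Prop :=
  ∃ h : U ⟶ T.obj, h ≫ T.d₀ = x ∧ h ≫ T.d₁ = y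

variable (C) in
/-- A Gumm category: a finitely complete category in which the Shifting Lemma holds. For
equivalence relations `T`, `S`, `R` on `X` with `R ∩ S ⊆ T`, if `x S y`, `x' S y'`, `x R x'`,
`y R y'` and `x T x'`, then `y T y'` (on generalized elements). -/
structure IsGummCategory : Prop where
  hasFiniteLimits : HasFiniteLimits C
  shifting : ∀ {X : C} (T S R : InternalEquiv X),
    (∀ {U : C} (a b : U ⟶ X), R.Rel a b → S.Rel a b → T.Rel a b) →
    ∀ {U : C} (x y x' y' : U ⟶ X), S.Rel x y → S.Rel x' y' → R.Rel x x' → R.Rel y y' →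
      T.Rel x x' → T.Rel y y'

/-- In a pointed category: a zero morphism is one which factors through a zero object. -/
def IsZeroMor {X Y : C} (f : X ⟶ Y) : Prop :=
  ∃ (O : C) (_ : IsZero O) (a : X ⟶ O) (b : O ⟶ Y), f = a ≫ b

/-- The span `(f, g)` is punctual with respect to the sections `s` of `f` and `t` of `g`. -/
structure IsPunctualSpan {W X Z : C} (f : W ⟶ X) (g : W ⟶ Z) (s : X ⟶ W) (t : Z ⟶ W) : Prop where
  section_left : s ≫ f = 𝟙 X
  section_right : t ≫ g = 𝟙 Z
  left_punctual : IsZeroMor (s ≫ g)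
  right_punctual : IsZeroMor (t ≫ f)

variable (C) in
/-- A congruence hyperextensible category: a finitely complete pointed category such that, for
any punctual span `(f, g)` on `W` with sections `(s, t)` and any equivalence relation `T` on `W`,
`R[f] ∩ R[g] ⊆ T` implies `R[f] ∩ g⁻¹(t⁻¹(T)) ⊆ T`. Here `R[f]` is the kernel equivalence relation
of `f`: the generalized elements `x`, `x'` are related by it when `x ≫ f = x' ≫ f`. -/
structure IsCongruenceHyperextensible : Prop where
  hasFiniteLimits : HasFiniteLimits C
  hasZeroObject : HasZeroObject C
  hyperextensible : ∀ {W X Z : C} (f : W ⟶ X) (g : W ⟶ Z) (s : X ⟶ W) (t : Z ⟶ W),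
    IsPunctualSpan f g s t → ∀ T : InternalEquiv W,
    (∀ {U : C} (x x' : U ⟶ W), x ≫ f = x' ≫ f → x ≫ g = x' ≫ g → T.Rel x x') →
    ∀ {U : C} (x x' : U ⟶ W), x ≫ f = x' ≫ f →
      T.Rel (x ≫ g ≫ t) (x' ≫ g ≫ t) → T.Rel x x'

/-- The fibre above `Y` of the fibration of points: split epimorphisms onto `Y` with a chosen
section, i.e. the coslice under `1_Y` of the slice category over `Y`. -/
abbrev Pt (Y : C) := Under (Over.mk (𝟙 Y))

end Categorical

/-- A `Hex`-algebra: a pointed set with a binary operation `circ` and a unary operation `upsilon`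
such that `a ∘ 0 = 0 ∘ a` and `υ (a ∘ 0) = a`. As the variety is pointed, `0` is its only constant:
`{0}` is a subalgebra. -/
structure HexAlgebra (H : Type w) where
  zero : H
  circ : H → H → H
  upsilon : H → H
  circ_zero_zero : circ zero zero = zero
  upsilon_zero : upsilon zero = zero
  circ_comm_zero : ∀ a, circ a zero = circ zero a
  upsilon_circ_zero : ∀ a, upsilon (circ a zero) = a

end GummVar

/-!
Everything rests on the shifting principle. If `x R x'`, `x T x'`, `y R y'` for congruences `R`,
`T` and `y S x`, `x' S y'` for a reflexive compatible relation `S`, put `z = α(p(y, x, x'), x)`.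
Replacing `x` by `x'` in `y = α(p(y, x, x), x)` gives `y R z` and `y T z`, while replacing `y` by
`x` and `x'` by `y'` in `z` gives `z S α(p(x, x, y'), x) = α(p(y', x, x), x) = y'`. So `z` and `y'`
are related by `R` and `S`, and `y T z T y'` as soon as `R ∩ S ⊆ T`.

For modularity, `a ⊔ b` is the union of the compatible relations `b`, `b ∘ a ∘ b`,
`(b ∘ a ∘ b) ∘ a ∘ (b ∘ a ∘ b)`, …, and the principle is applied along this chain. The categorical
statements reduce to elements, because a conservative functor to algebras preserving pullbacks and
equalizers detects internal relations; the forgetful functor of a fibre of points is one, although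
it does not preserve products. Finally the Shifting Lemma in a pointed category, applied to `R[f]`,
`R[g]` and the images of `x`, `x'` under `tg`, is hyperextensibility.
-/

namespace GummVar

open FirstOrder FirstOrder.Language FirstOrder.Language.Structure

section Compatible

variable {L : FirstOrder.Language.{u, u'}} {A : Type w} [L.Structure A]

variable (L) in
/-- A binary relation on an `L`-algebra is compatible if it is preserved by every operation, i.e.
if it is a subalgebra of `A × A`. -/
def Compatible (r : A → A → Prop) : Prop :=
  ∀ {n : ℕ} (F : L.Functions n) (x y : Fin n → A), (∀ i, r (x i) (y i)) →
    r (funMap F x) (funMap F y)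

namespace Compatible

variable {r s : A → A → Prop}

theorem realize (hr : Compatible L r) {β : Type*} (t : L.Term β) {x y : β → A}
    (h : ∀ i, r (x i) (y i)) : r (t.realize x) (t.realize y) := by
  induction t with
  | var i => exact h i
  | func F ts ih => exact hr F _ _ ih

theorem realize₂ (hr : Compatible L r) (t : L.Term (Fin 2)) {a b a' b' : A}
    (ha : r a a') (hb : r b b') : r (t.realize ![a, b]) (t.realize ![a', b']) :=
  hr.realize t fun i => by fin_cases i <;> assumption

theorem realize₃ (hr : Compatible L r) (t : L.Term (Fin 3)) {a b c a' b' c' : A}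
    (ha : r a a') (hb : r b b') (hc : r c c') :
    r (t.realize ![a, b, c]) (t.realize ![a', b', c']) :=
  hr.realize t fun i => by fin_cases i <;> assumption

theorem comp (hr : Compatible L r) (hs : Compatible L s) : Compatible L (Relation.Comp r s) := by
  intro n F x y h
  choose z hxz hzy using h
  exact ⟨funMap F z, hr F x z hxz, hs F z y hzy⟩

theorem exists_of_directed {ι : Type*} [Nonempty ι] {r : ι → A → A → Prop}
    (hr : ∀ i, Compatible L (r i)) (hd : Directed (· ≤ ·) r) :
    Compatible L fun x y => ∃ i, r i x y := by
  classical
  intro n F x y h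
  choose i hi using h
  obtain ⟨j, hj⟩ := hd.finset_le (Finset.univ.image i)
  exact ⟨j, hr j F x y fun k => hj (i k) (by simp) _ _ (hi k)⟩

theorem ker {B : Type*} [L.Structure B] (f : A →[L] B) : Compatible L fun a b => f a = f b := by
  intro n F x y h
  simp only [f.map_fun, funext h, Function.comp_def]

end Compatible

variable (L A) in
/-- Gumm's shifting principle for the algebra `A`: the Shifting Lemma for two congruences `R`, `T`
and a relation `S` which is only required to be reflexive and compatible. As `S` need not be
symmetric, the two instances of `S` are oriented towards `x` and away from `x'`. -/
def ShiftingPrinciple : Prop :=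
  ∀ (R T : Congruence L A) (S : A → A → Prop), (∀ a, S a a) → Compatible L S →
    (∀ a b, R.r a b → S a b → T.r a b) →
    ∀ {x y x' y' : A}, S y x → S x' y' → R.r x x' → R.r y y' → T.r x x' → T.r y y'

theorem shiftingPrinciple_of_terms (p : L.Term (Fin 3)) (α : L.Term (Fin 2))
    (hp : ∀ x y : A, p.realize ![x, y, y] = p.realize ![y, y, x])
    (hα : ∀ x y : A, α.realize ![p.realize ![x, y, y], y] = x) : ShiftingPrinciple L A := by
  intro R T S S_refl S_compat hRST x y x' y' hSyx hSxy' hRx hRy hTx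
  let z := α.realize ![p.realize ![y, x, x'], x]
  have rel_z (Q : Congruence L A) (hQ : Q.r x x') : Q.r y z := by
    have Q_compat : Compatible L Q.r := Q.compat
    simpa only [hα] using
      Q_compat.realize₂ α (Q_compat.realize₃ p (Q.refl y) (Q.refl x) hQ) (Q.refl x)
  have hSz : S z y' := by
    have h := S_compat.realize₂ α (S_compat.realize₃ p hSyx (S_refl x) hSxy') (S_refl x)
    rwa [← hp, hα] at h
  have hRz : R.r z y' := R.trans (R.symm (rel_z R hRx)) hRy
  exact T.trans (rel_z T hTx) (hRST z y' hRz hSz)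

/-- The structure of `Hex`-algebra on a fibre of a homomorphism `f`, pointed by one of its elements
`e`, given by the operations `u ∘ v = p(u, e, v)` and `υ(u) = α(u, e)`. -/
def fiberHexAlgebra {B : Type*} [L.Structure B] (p : L.Term (Fin 3)) (α : L.Term (Fin 2))
    (f : A →[L] B) {e : A} {y : B} (he : f e = y)
    (hp : ∀ a : A, p.realize ![a, e, e] = p.realize ![e, e, a])
    (hp' : p.realize ![e, e, e] = e)
    (hα : ∀ a : A, α.realize ![p.realize ![a, e, e], e] = a) :
    HexAlgebra {a : A // f a = y} :=
  have ker : Compatible L fun a b : A => f a = f b := Compatible.ker f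
  have hα' : α.realize ![e, e] = e := by simpa only [hp'] using hα e
  { zero := ⟨e, he⟩
    circ a b := ⟨p.realize ![a, e, b], by
      simpa only [hp', he] using
        ker.realize₃ p (a.2.trans he.symm) (Eq.refl (f e)) (b.2.trans he.symm)⟩
    upsilon a := ⟨α.realize ![a, e], by
      simpa only [hα', he] using
        ker.realize₂ α (a.2.trans he.symm) (Eq.refl (f e))⟩
    circ_zero_zero := Subtype.ext hp'
    upsilon_zero := Subtype.ext hα'
    circ_comm_zero a := Subtype.ext (hp a)
    upsilon_circ_zero a := Subtype.ext (hα a) }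

end Compatible

namespace Congruence

variable {L : FirstOrder.Language.{u, u'}} {A : Type w} [L.Structure A] (a b : Congruence L A)

/-- The increasing sequence of reflexive, symmetric, compatible relations
`b`, `b ∘ a ∘ b`, `(b ∘ a ∘ b) ∘ a ∘ (b ∘ a ∘ b)`, … whose union is the join of `a` and `b`. -/
def chain : ℕ → A → A → Prop
  | 0 => b.r
  | n + 1 => Relation.Comp (chain n) (Relation.Comp a.r (chain n))

theorem chain_refl (n : ℕ) (x : A) : chain a b n x x := by
  induction n with
  | zero => exact b.refl x
  | succ n ih => exact ⟨x, ih, x, a.refl x, ih⟩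

theorem chain_symm (n : ℕ) {x y : A} (h : chain a b n x y) : chain a b n y x := by
  induction n generalizing x y with
  | zero => exact b.symm h
  | succ n ih =>
    obtain ⟨u, hxu, v, huv, hvy⟩ := h
    exact ⟨v, ih hvy, u, a.symm huv, ih hxu⟩

theorem chain_compatible (n : ℕ) : Compatible L (chain a b n) := by
  induction n with
  | zero => exact b.compat
  | succ n ih => exact ih.comp (Compatible.comp a.compat ih)

theorem chain_monotone : Monotone (chain a b) :=
  monotone_nat_of_le_succ fun n _ y h => ⟨y, h, y, a.refl y, chain_refl a b n y⟩

/-- The union of the relations `chain a b n`, as a congruence. -/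
def chainUnion : Congruence L A where
  r x y := ∃ n, chain a b n x y
  iseqv :=
    { refl x := ⟨0, chain_refl a b 0 x⟩
      symm := fun ⟨n, h⟩ => ⟨n, chain_symm a b n h⟩
      trans := fun {_ y _} ⟨m, h⟩ ⟨n, h'⟩ =>
        ⟨max m n + 1, y, chain_monotone a b (le_max_left m n) _ _ h, y, a.refl y,
          chain_monotone a b (le_max_right m n) _ _ h'⟩ }
  compat := Compatible.exists_of_directed (chain_compatible a b) (chain_monotone a b).directed_le

theorem sup_le_chainUnion : a ⊔ b ≤ chainUnion a b :=
  sup_le (fun x y h => ⟨1, x, chain_refl a b 0 x, y, h, chain_refl a b 0 y⟩) fun _ _ h => ⟨0, h⟩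

variable {a b} in
theorem inf_r {x y : A} (ha : a.r x y) (hb : b.r x y) : (a ⊓ b).r x y := by
  rintro _ ⟨_, rfl | rfl, rfl⟩
  exacts [ha, hb]

theorem isModularLattice_of_shiftingPrinciple (hA : ShiftingPrinciple L A) :
    IsModularLattice (Congruence L A) where
  sup_inf_le_assoc_of_le {a} b {c} hac := by
    set d := a ⊔ b ⊓ c
    have had : a ≤ d := le_sup_left
    have hbcd : b ⊓ c ≤ d := le_sup_right
    have chain_le (n : ℕ) : ∀ x y, c.r x y → chain a b n x y → d.r x y := by
      induction n with
      | zero => exact fun x y hc hb => hbcd (inf_r hb hc)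
      | succ n ih =>
        rintro x y hc ⟨u, hxu, v, huv, hvy⟩
        exact hA c d (chain a b n) (chain_refl a b n) (chain_compatible a b n) ih
          hxu hvy (hac huv) hc (had huv)
    intro x y h
    have hsup : (a ⊔ b).r x y := (inf_le_left : (a ⊔ b) ⊓ c ≤ a ⊔ b) h
    have hc : c.r x y := (inf_le_right : (a ⊔ b) ⊓ c ≤ c) h
    obtain ⟨n, hn⟩ := sup_le_chainUnion a b hsup
    exact chain_le n x y hc hn

end Congruence

section JointPullback

variable {C : Type u₁} [Category.{v₁} C] [HasPullbacks C] [HasEqualizers C] {A B X Z : C}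

/-- The limit of the diagram formed by two spans `X ← A → Z` and `X ← B → Z`. It is built from
connected limits rather than as a pullback over `X ⨯ Z`, because forgetful functors from fibres of
points do not preserve products. -/
noncomputable abbrev jointPullback (c : A ⟶ X) (c' : A ⟶ Z) (d : B ⟶ X) (d' : B ⟶ Z) : C :=
  equalizer (pullback.fst c d ≫ c') (pullback.snd c d ≫ d')

namespace jointPullback

variable (c : A ⟶ X) (c' : A ⟶ Z) (d : B ⟶ X) (d' : B ⟶ Z)

/-- The first projection of a joint pullback. -/
noncomputable def fst : jointPullback c c' d d' ⟶ A := equalizer.ι _ _ ≫ pullback.fst c d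

/-- The second projection of a joint pullback. -/
noncomputable def snd : jointPullback c c' d d' ⟶ B := equalizer.ι _ _ ≫ pullback.snd c d

theorem condition_left : fst c c' d d' ≫ c = snd c c' d d' ≫ d := by
  simp only [fst, snd, Category.assoc, pullback.condition]

theorem condition_right : fst c c' d d' ≫ c' = snd c c' d d' ≫ d' := by
  simpa only [fst, snd, Category.assoc] using equalizer.condition _ _

instance : JointlyMono₂ (fst c c' d d') (snd c c' d d') where
  right_cancellation _ f g h₁ h₂ := equalizer.hom_ext <| pullback.hom_ext
    (by simpa only [fst, Category.assoc] using h₁) (by simpa only [snd, Category.assoc] using h₂)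

end jointPullback

variable (F : C ⥤ Type w) [PreservesLimitsOfShape WalkingCospan F]
  [PreservesLimitsOfShape WalkingParallelPair F]

theorem jointPullback.exists_map_eq {c : A ⟶ X} {c' : A ⟶ Z} {d : B ⟶ X} {d' : B ⟶ Z}
    {a : F.obj A} {b : F.obj B} (h : F.map c a = F.map d b) (h' : F.map c' a = F.map d' b) :
    ∃ k, F.map (fst c c' d d') k = a ∧ F.map (snd c c' d d') k = b := by
  obtain ⟨m, rfl, rfl⟩ :=
    Types.exists_of_isPullback ((IsPullback.of_hasPullback c d).map F) a b h
  obtain ⟨k, rfl, -⟩ := Types.unique_of_type_equalizer _ _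
    (isLimitForkMapOfIsLimit F (equalizer.condition _ _)
      (equalizerIsEqualizer (pullback.fst c d ≫ c') (pullback.snd c d ≫ d')))
    m (by simpa only [Functor.map_comp_apply] using h')
  exact ⟨k, Functor.map_comp_apply _ _ _ _, Functor.map_comp_apply _ _ _ _⟩

theorem map_ext_of_jointlyMono₂ {R : C} (p : R ⟶ X) (q : R ⟶ Z) [hpq : JointlyMono₂ p q]
    {k l : F.obj R} (hp : F.map p k = F.map p l) (hq : F.map q k = F.map q l) : k = l := by
  obtain ⟨m, rfl, rfl⟩ := jointPullback.exists_map_eq F hp hq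
  rw [hpq.right_cancellation _ _ (jointPullback.condition_left p q p q)
    (jointPullback.condition_right p q p q)]

theorem jointlyMono₂_map {R : C} (p : R ⟶ X) (q : R ⟶ Z) [JointlyMono₂ p q] :
    JointlyMono₂ (F.map p) (F.map q) where
  right_cancellation _ f g hp hq := by
    ext x
    exact map_ext_of_jointlyMono₂ F p q congr($hp x) congr($hq x)

end JointPullback

namespace InternalEquiv

variable {C : Type u₁} [Category.{v₁} C]

/-- The kernel equivalence relation `R[f]` of a morphism `f`. -/
noncomputable def ker [HasPullbacks C] {X Y : C} (f : X ⟶ Y) : InternalEquiv X where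
  obj := pullback f f
  d₀ := pullback.fst f f
  d₁ := pullback.snd f f
  isEquivalenceRelation := (IsKernelPair.equivalenceRelation f _ _
    (pullbackIsPullback _ _) (IsPullback.of_hasPullback f f)).isEquivalenceRelation

theorem ker_rel_iff [HasPullbacks C] {X Y U : C} {f : X ⟶ Y} {x y : U ⟶ X} :
    (ker f).Rel x y ↔ x ≫ f = y ≫ f := by
  constructor
  · rintro ⟨h : U ⟶ pullback f f, rfl, rfl⟩
    change (h ≫ pullback.fst f f) ≫ f = (h ≫ pullback.snd f f) ≫ f
    simp only [Category.assoc, pullback.condition]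
  · exact fun h => ⟨pullback.lift x y h, pullback.lift_fst x y h, pullback.lift_snd x y h⟩

variable (F : C ⥤ Type w) {X : C} (T : InternalEquiv X)

instance : JointlyMono₂ T.d₀ T.d₁ :=
  T.isEquivalenceRelation.nonempty_equivalenceRelation.some.toJointlyMono₂

/-- The relation induced by `T` on the set `F.obj X` of elements of `X`. -/
abbrev ElemRel : F.obj X → F.obj X → Prop := TypeCat.Rel.ofPair (F.map T.d₀) (F.map T.d₁)

variable {T} in
theorem Rel.elemRel {U : C} {x y : U ⟶ X} (h : T.Rel x y) (k : F.obj U) :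
    T.ElemRel F (F.map x k) (F.map y k) := by
  obtain ⟨h, rfl, rfl⟩ := h
  exact ⟨F.map h k, (Functor.map_comp_apply _ _ _ _).symm, (Functor.map_comp_apply _ _ _ _).symm⟩

variable [HasPullbacks C] [HasEqualizers C] [PreservesLimitsOfShape WalkingCospan F]
  [PreservesLimitsOfShape WalkingParallelPair F]

theorem elemRel_equivalence : Equivalence (T.ElemRel F) := by
  obtain ⟨⟨e⟩⟩ := T.isEquivalenceRelation
  have := jointlyMono₂_map F T.d₀ T.d₁
  exact TypeCat.equivalence_of_equivalenceRelation
    { e.toReflexiveRelation.map F, e.toSymmetricRelation.map F, e.toTransitiveRelation.map F with }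

theorem rel_of_elemRel [F.ReflectsIsomorphisms] {U : C} {x y : U ⟶ X}
    (h : ∀ k, T.ElemRel F (F.map x k) (F.map y k)) : T.Rel x y := by
  let π := jointPullback.fst x y T.d₀ T.d₁
  let ρ := jointPullback.snd x y T.d₀ T.d₁
  have hx : π ≫ x = ρ ≫ T.d₀ := jointPullback.condition_left x y T.d₀ T.d₁
  have hy : π ≫ y = ρ ≫ T.d₁ := jointPullback.condition_right x y T.d₀ T.d₁
  have π_injective : Function.Injective (F.map π) := fun k l hkl =>
    map_ext_of_jointlyMono₂ F π ρ hkl <| map_ext_of_jointlyMono₂ F T.d₀ T.d₁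
      (by simp only [← Functor.map_comp_apply, ← hx]; simp only [Functor.map_comp_apply, hkl])
      (by simp only [← Functor.map_comp_apply, ← hy]; simp only [Functor.map_comp_apply, hkl])
  have π_surjective : Function.Surjective (F.map π) := fun u => by
    obtain ⟨t, h₀, h₁⟩ := h u
    obtain ⟨k, hk, -⟩ := jointPullback.exists_map_eq F h₀.symm h₁.symm
    exact ⟨k, hk⟩
  have : IsIso (F.map π) := (isIso_iff_bijective _).2 ⟨π_injective, π_surjective⟩
  have : IsIso π := isIso_of_reflects_iso π F
  exact ⟨inv π ≫ ρ, by simp [← hx], by simp [← hy]⟩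

variable {T} in
theorem elemRel_of_inter_le {R S : InternalEquiv X}
    (h : ∀ {U : C} (a b : U ⟶ X), R.Rel a b → S.Rel a b → T.Rel a b) {a b : F.obj X}
    (hR : R.ElemRel F a b) (hS : S.ElemRel F a b) : T.ElemRel F a b := by
  obtain ⟨r, rfl, rfl⟩ := hR
  obtain ⟨s, h₀, h₁⟩ := hS
  obtain ⟨m, rfl, rfl⟩ := jointPullback.exists_map_eq F h₀.symm h₁.symm
  let π := jointPullback.fst R.d₀ R.d₁ S.d₀ S.d₁
  have hT : T.Rel (π ≫ R.d₀) (π ≫ R.d₁) := h _ _ ⟨π, rfl, rfl⟩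
    ⟨_, (jointPullback.condition_left _ _ _ _).symm, (jointPullback.condition_right _ _ _ _).symm⟩
  simpa only [Functor.map_comp_apply] using hT.elemRel F m

end InternalEquiv

section Pointed

variable {C : Type u₁} [Category.{v₁} C]

theorem IsZeroMor.comp_left_eq {U X Y : C} {f : X ⟶ Y} (hf : IsZeroMor f) (x x' : U ⟶ X) :
    x ≫ f = x' ≫ f := by
  obtain ⟨O, hO, a, b, rfl⟩ := hf
  rw [← Category.assoc, ← Category.assoc, hO.eq_of_tgt (x ≫ a) (x' ≫ a)]

theorem IsGummCategory.isCongruenceHyperextensible [HasZeroObject C] (hC : IsGummCategory C) :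
    IsCongruenceHyperextensible C where
  hasFiniteLimits := hC.hasFiniteLimits
  hasZeroObject := inferInstance
  hyperextensible := by
    intro W X Z f g s t hst T hT U x x' hf hxx'
    have := hC.hasFiniteLimits
    have g_eq (z : U ⟶ W) : (InternalEquiv.ker g).Rel (z ≫ g ≫ t) z :=
      InternalEquiv.ker_rel_iff.2 (by simp only [Category.assoc, hst.section_right,
        Category.comp_id])
    have f_eq : (InternalEquiv.ker f).Rel (x ≫ g ≫ t) (x' ≫ g ≫ t) :=
      InternalEquiv.ker_rel_iff.2 (by
        simpa only [Category.assoc] using hst.right_punctual.comp_left_eq (x ≫ g) (x' ≫ g))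
    refine hC.shifting T (.ker g) (.ker f) (fun a b ha hb => ?_) _ x _ x' (g_eq x) (g_eq x') f_eq
      (InternalEquiv.ker_rel_iff.2 hf) hxx'
    exact hT a b (InternalEquiv.ker_rel_iff.1 ha) (InternalEquiv.ker_rel_iff.1 hb)

theorem isZero_under_mk_id {X : C} (hX : IsTerminal X) : IsZero (Under.mk (𝟙 X)) where
  unique_to B := ⟨⟨⟨Under.mkIdInitial.to B⟩, fun _ => Under.mkIdInitial.hom_ext _ _⟩⟩
  unique_from B := ⟨⟨⟨Under.homMk (hX.from B.right) (hX.hom_ext _ _)⟩,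
    fun _ => Under.UnderMorphism.ext (hX.hom_ext _ _)⟩⟩

instance (Y : C) : HasZeroObject (Pt Y) := ⟨_, isZero_under_mk_id Over.mkIdTerminal⟩

end Pointed

namespace Variety

variable {L : FirstOrder.Language.{u, u'}} {V : Variety L}

instance : ConcreteCategory (Alg.{u, u', w} V) (fun A B => A →[L] B) where
  hom f := f
  ofHom f := f

theorem compatible_ofPair {K A : Alg.{u, u', w} V} (d₀ d₁ : K ⟶ A) :
    Compatible L (TypeCat.Rel.ofPair ((forget V.Alg).map d₀) ((forget V.Alg).map d₁)) := by
  intro n F x y h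
  choose k h₀ h₁ using h
  obtain rfl : _ = x := funext h₀
  obtain rfl : _ = y := funext h₁
  exact ⟨funMap F k, Hom.map_fun d₀ F k, Hom.map_fun d₁ F k⟩

variable [L.IsAlgebraic]

/-- A map of algebras preserving the operations, as a morphism. -/
def homMk {A B : Alg.{u, u', w} V} (f : A → B)
    (hf : ∀ {n : ℕ} (F : L.Functions n) (x : Fin n → A), f (funMap F x) = funMap F (f ∘ x)) :
    A ⟶ B :=
  ConcreteCategory.ofHom (C := V.Alg)
    ({ toFun := f, map_fun' := hf, map_rel' := fun r => isEmptyElim r } : A →[L] B)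

instance : (forget (Alg.{u, u', w} V)).ReflectsIsomorphisms where
  reflects {A B} f hf := by
    let e : A ≃ B := Equiv.ofBijective f ((isIso_iff_bijective _).1 hf)
    have e_map {n : ℕ} (F : L.Functions n) (x : Fin n → A) : e (funMap F x) = funMap F (e ∘ x) :=
      Hom.map_fun f F x
    refine ⟨homMk e.symm fun F x => ?_, ConcreteCategory.hom_ext _ _ e.symm_apply_apply,
      ConcreteCategory.hom_ext _ _ e.apply_symm_apply⟩
    rw [Equiv.symm_apply_eq, e_map, ← Function.comp_assoc, e.self_comp_symm, Function.id_comp]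

section Limits

variable {J : Type w} [SmallCategory J] (G : J ⥤ Alg.{u, u', w} V)

instance : L.Structure (G ⋙ forget V.Alg).sections where
  funMap F x := ⟨fun j => funMap (M := G.obj j) F fun i => (x i).1 j, fun {_ _} f =>
    (Hom.map_fun (G.map f) F _).trans (congrArg _ (funext fun i => (x i).2 f))⟩
  RelMap r := isEmptyElim r

/-- The projections of the algebra of sections, as homomorphisms. -/
def sectionsProj (j : J) : (G ⋙ forget V.Alg).sections →[L] G.obj j where
  toFun x := x.1 j
  map_fun' _ _ := rfl
  map_rel' r := isEmptyElim r

/-- The limit cone of a diagram of algebras, computed on underlying sets. -/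
def limitCone : Cone G where
  pt :=
    { carrier := (G ⋙ forget V.Alg).sections
      models := fun e he x => Subtype.ext <| funext fun j => by
        have proj_realize (t : L.Term ℕ) :
            (t.realize x).1 j = t.realize (sectionsProj G j ∘ x) :=
          (HomClass.realize_term (sectionsProj G j)).symm
        rw [proj_realize, proj_realize]
        exact (G.obj j).models e he _ }
  π :=
    { app := fun j => sectionsProj G j
      naturality := fun _ _ f => ConcreteCategory.hom_ext _ _ fun x => (x.2 f).symm }

/-- The universal property of `limitCone G`, with lifts constructed pointwise. -/
def limitConeIsLimit : IsLimit (limitCone G) where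
  lift s := homMk (fun a => ⟨fun j => s.π.app j a, fun f => ConcreteCategory.congr_hom (s.w f) a⟩)
    fun F x => Subtype.ext (funext fun j => Hom.map_fun (s.π.app j) F x)
  fac _ _ := rfl
  uniq _ _ h := ConcreteCategory.hom_ext _ _ fun a =>
    Subtype.ext (funext fun j => ConcreteCategory.congr_hom (h j) a)

instance : HasLimitsOfSize.{w, w} (Alg.{u, u', w} V) :=
  ⟨fun _ _ => ⟨fun G => ⟨⟨limitCone G, limitConeIsLimit G⟩⟩⟩⟩

instance : PreservesLimitsOfSize.{w, w} (forget (Alg.{u, u', w} V)) :=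
  ⟨⟨fun {G} => preservesLimit_of_preserves_limit_cone (limitConeIsLimit G)
    (Types.limitConeIsLimit (G ⋙ forget V.Alg))⟩⟩

instance : HasFiniteLimits (Alg.{u, u', w} V) :=
  hasFiniteLimits_of_hasLimitsOfSize.{w, w} _

instance : PreservesFiniteLimits (forget (Alg.{u, u', w} V)) :=
  PreservesLimitsOfSize.preservesFiniteLimits.{w, w} _

end Limits

variable {C : Type u₁} [Category.{v₁} C] (F : C ⥤ Alg.{u, u', w} V)
  [PreservesLimitsOfShape WalkingCospan F] [PreservesLimitsOfShape WalkingParallelPair F]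

/-- The congruence induced on the algebra `F.obj X` by an equivalence relation on `X`. -/
def elemCongruence [HasPullbacks C] [HasEqualizers C] {X : C} (T : InternalEquiv X) :
    Congruence L (F.obj X) where
  r := T.ElemRel (F ⋙ forget V.Alg)
  iseqv := T.elemRel_equivalence _
  compat := compatible_ofPair (F.map T.d₀) (F.map T.d₁)

theorem isGummCategory_of_shiftingPrinciple [HasFiniteLimits C] [F.ReflectsIsomorphisms]
    (hV : ∀ A : Alg.{u, u', w} V, ShiftingPrinciple L A) : IsGummCategory C where
  hasFiniteLimits := inferInstance
  shifting := by
    intro X T S R h U x y x' y' hSxy hSxy' hRx hRy hTx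
    let G := F ⋙ forget V.Alg
    refine T.rel_of_elemRel G fun k => ?_
    exact hV (F.obj X) (elemCongruence F R) (elemCongruence F T) (S.ElemRel G)
      (elemCongruence F S).refl (elemCongruence F S).compat
      (fun _ _ => InternalEquiv.elemRel_of_inter_le G h)
      ((elemCongruence F S).symm (hSxy.elemRel G k)) (hSxy'.elemRel G k)
      (hRx.elemRel G k) (hRy.elemRel G k) (hTx.elemRel G k)

end Variety

end GummVar

theorem mainTheorem8 (L : FirstOrder.Language.{u, u'}) [L.IsAlgebraic] (V : GummVar.Variety L)
    (p : L.Term (Fin 3)) (α : L.Term (Fin 2))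
    (hp : ∀ (A : GummVar.Variety.Alg.{u, u', w} V) (x y : A),
      p.realize ![x, y, y] = p.realize ![y, y, x])
    (hp' : ∀ (A : GummVar.Variety.Alg.{u, u', w} V) (x : A), p.realize ![x, x, x] = x)
    (hα : ∀ (A : GummVar.Variety.Alg.{u, u', w} V) (x y : A),
      α.realize ![p.realize ![x, y, y], y] = x) :
    GummVar.Variety.IsCongruenceModular.{u, u', w} V ∧
    (∀ (X Y : GummVar.Variety.Alg.{u, u', w} V) (f : L.Hom X Y) (s : L.Hom Y X),
      (∀ y, f (s y) = y) → ∀ y : Y, ∃ H : GummVar.HexAlgebra {a : X // f a = y},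
        (H.zero : X) = s y ∧
        (∀ a b, (H.circ a b : X) = p.realize ![(a : X), s y, (b : X)]) ∧
        ∀ a, (H.upsilon a : X) = α.realize ![(a : X), s y]) ∧
    (∀ Y : GummVar.Variety.Alg.{u, u', w} V,
      GummVar.IsCongruenceHyperextensible (GummVar.Pt Y)) ∧
    GummVar.IsGummCategory (GummVar.Variety.Alg.{u, u', w} V) := by
  have shifting (A : GummVar.Variety.Alg.{u, u', w} V) : GummVar.ShiftingPrinciple L A :=
    GummVar.shiftingPrinciple_of_terms p α (hp A) (hα A)
  refine ⟨fun A => GummVar.Congruence.isModularLattice_of_shiftingPrinciple (shifting A),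
    fun X Y f s hfs y => ?_, fun Y => ?_,
    GummVar.Variety.isGummCategory_of_shiftingPrinciple (𝟭 _) shifting⟩
  · exact ⟨GummVar.fiberHexAlgebra p α f (hfs y) (fun a => hp X a (s y)) (hp' X (s y))
      fun a => hα X a (s y), rfl, fun _ _ => rfl, fun _ => rfl⟩
  · have pt_gumm : GummVar.IsGummCategory (GummVar.Pt Y) :=
      GummVar.Variety.isGummCategory_of_shiftingPrinciple
        (Under.forget _ ⋙ Over.forget Y) shifting
    exact pt_gumm.isCongruenceHyperextensible
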